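/- Let $\mathcal X$ be a separable metric space with its Borel $\sigma$-algebra, $\mathcal Y\subseteq\mathbb R$ closed, and let $\mathcal X=\mathcal X_1\cup\dots\cup\mathcal X_B$, where the regions $\mathcal X_b$ may overlap and each $\mathcal X_b$ is a complete (separable) metric space. Let $w_b:\mathcal X\to[0,1]$ be measurable weights with $\sum_{b=1}^B w_b(x)=1$ for all $x\in\mathcal X$ and $w_b(x)=0$ for $x\notin\mathcal X_b$, and let $\lambda_1,\dots,\lambda_B>0$. For every $b$ let $H_b$ be the reproducing kernel Hilbert space of a bounded and continuous kernel $k_b$ on $\mathcal X_b$. Let $L:\mathcal Y\times\mathbb R\to[0,\infty)$ be a measurable loss function that is convex in its last argument and Lipschitz continuous in its last argument with constant $|L|_1$ (uniformly in $y$), such that $L(y,\cdot)$ is twice continuously differentiable for every $y\in\mathcal Y$, with derivatives $L'(y,\cdot)$, $L''(y,\cdot)$ satisfying $\sup_{y\in\mathcal Y}\sup_{t\in\mathbb R}|L'(y,t)|\in(0,\infty)$ and $\sup_{y\in\mathcal Y}\sup_{t\in\mathbb R}|L''(y,t)|<\infty$. For a probability measure $\nu$ on $\mathcal X_b\times\mathcal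 Y$ let $S_b(\nu)$ be the local support vector machine, i.e. the minimizer over $f\in H_b$ of $$\int \big(L(y,f(x))-L(y,0)\big)\,d\nu(x,y)+\lambda_b\|f\|_{H_b}^2 ,$$ which exists and is unique; if $\nu$ is not a probability measure, let $S_b(\nu)$ be an arbitrary measurable function on $\mathcal X_b$. For a probability measure $P$ on $\mathcal X\times\mathcal Y$ with marginal $P^X$ on $\mathcal X$, let $P_b$ be $P(\mathcal X_b\times\mathcal Y)^{-1}$ times the restriction of $P$ to $\mathcal X_b\times\mathcal Y$ if $P(\mathcal X_b\times\mathcal Y)>0$, and the null measure otherwise. For $z\in\mathcal X\times\mathcal Y$ and $\varepsilon\in(0,1]$ put $$\tilde P_{b,\varepsilon,z}:=\begin{cases}(1-\varepsilon)P_b+\varepsilon\delta_z & \text{if } z\in\mathcal X_b\times\mathcal Y,\\ P_b&\text{otherwise.}\end{cases}$$ The composed predictor under $P$ is $f^{comp}_P:=\sum_{b=1}^B w_b\,S_b(P_b)$, and the composed predictor under contamination of $P$ at $z$ with weight $\varepsilon$ is $f^{comp}_{P,\varepsilon,z}:=\sum_{b=1}^B w_b\,S_b(\tilde P_{b,\varepsilon,z})$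 (the summands being $0$ outside $\mathcal X_b$). Then for all $P$ and all $z$ these predictors belong to $L^\infty(P^X)$, the influence function of the composed predictor $$\mathrm{IF}^{comp}(\delta_z;S,P):=\lim_{\varepsilon\downarrow0}\frac{f^{comp}_{P,\varepsilon,z}-f^{comp}_P}{\varepsilon}$$ exists as a limit in $L^\infty(P^X)$, and $$\|\mathrm{IF}^{comp}(\delta_z;S,P)\|_{L^\infty(P^X)}\le 2\,|L|_1\sum_{b=1}^B\Big(\sup_{x\in\mathcal X_b}w_b(x)\Big)\,\lambda_b^{-1}\,\Big(\sup_{x\in\mathcal X_b}\sqrt{k_b(x,x)}\Big)^2 .$$ In particular the bound does not depend on $z$ or $P$. -/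

import Mathlib

open MeasureTheory Filter Topology Set
open scoped ENNReal NNReal

noncomputable section

namespace LocalSVM

/-- The scalar reproducing kernel `k(x, x')` of a real reproducing kernel Hilbert space `H` of
functions on `E`; here Mathlib's operator-valued kernel acts on the one-dimensional space `ℝ`. -/
def scalarKernel {E : Type*} (H : Type*) [NormedAddCommGroup H] [InnerProductSpace ℝ H]
    [CompleteSpace H] [RKHS ℝ H E ℝ] (x x' : E) : ℝ :=
  RKHS.kernel H x x' 1

/-- The sup-norm `sup_x √(k(x, x))` of the kernel of `H`. -/
def kernelNorm {E : Type*} (H : Type*) [NormedAddCommGroup H] [InnerProductSpace ℝ H]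
    [CompleteSpace H] [RKHS ℝ H E ℝ] : ℝ :=
  ⨆ x : E, √(scalarKernel H x x)

/-- The shifted loss `L*(y, t) = L(y, t) - L(y, 0)`. -/
def shiftedLoss {Y : Type*} (L : Y → ℝ → ℝ) (y : Y) (t : ℝ) : ℝ :=
  L y t - L y 0

/-- The regularized risk `∫ L*(y, f(x)) dν(x, y) + lam ‖f‖²` of an element `f` of `H`. -/
def regRisk {E Y H : Type*} [MeasurableSpace E] [MeasurableSpace Y]
    [NormedAddCommGroup H] [InnerProductSpace ℝ H] [RKHS ℝ H E ℝ]
    (L : Y → ℝ → ℝ) (lam : ℝ) (ν : Measure (E × Y)) (f : H) : ℝ :=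
  (∫ p, shiftedLoss L p.2 (f p.1) ∂ν) + lam * ‖f‖ ^ 2

/-- `f` is a support vector machine for the shifted loss, the law `ν` and the regularization
parameter `lam`: it minimizes the regularized risk over `H`. -/
def IsSVM {E Y H : Type*} [MeasurableSpace E] [MeasurableSpace Y]
    [NormedAddCommGroup H] [InnerProductSpace ℝ H] [RKHS ℝ H E ℝ]
    (L : Y → ℝ → ℝ) (lam : ℝ) (ν : Measure (E × Y)) (f : H) : Prop :=
  ∀ g : H, regRisk L lam ν f ≤ regRisk L lam ν g

/-- `f` is a local predictor for `ν`: an SVM if `ν` is a probability measure, and an arbitrary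
measurable function otherwise. -/
def IsLocalPredictor {E Y : Type*} (H : Type*) [MeasurableSpace E] [MeasurableSpace Y]
    [NormedAddCommGroup H] [InnerProductSpace ℝ H] [RKHS ℝ H E ℝ]
    (L : Y → ℝ → ℝ) (lam : ℝ) (ν : Measure (E × Y)) (f : E → ℝ) : Prop :=
  (IsProbabilityMeasure ν → ∃ h : H, IsSVM L lam ν h ∧ f = h) ∧
    (¬ IsProbabilityMeasure ν → Measurable f)

/-- The regional law on `R × Y`: `P` restricted to `R × Y` and normalized if `P(R × Y) > 0`,
and the null measure otherwise. -/
def regionalLaw {X Y : Type*} [MeasurableSpace X] [MeasurableSpace Y]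
    (P : Measure (X × Y)) (R : Set X) : Measure (R × Y) :=
  open Classical in
  if 0 < P (R ×ˢ univ) then
    (P (R ×ˢ univ))⁻¹ • P.comap (Prod.map (Subtype.val : R → X) (id : Y → Y))
  else 0

/-- The regional law contaminated at `z` with weight `ε`: the mixture
`(1 - ε) P_R + ε δ_z` if `z ∈ R × Y`, and the regional law `P_R` itself otherwise. -/
def contaminatedLaw {X Y : Type*} [MeasurableSpace X] [MeasurableSpace Y]
    (P : Measure (X × Y)) (R : Set X) (z : X × Y) (ε : ℝ) : Measure (R × Y) :=
  open Classical in
  if hz : z.1 ∈ R then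
    ENNReal.ofReal (1 - ε) • regionalLaw P R +
      ENNReal.ofReal ε • Measure.dirac ((⟨z.1, hz⟩ : R), z.2)
  else regionalLaw P R

/-- The composed predictor `x ↦ ∑_b w_b(x) f_b(x)`. The local predictor `f_b` is only defined on
the region `R b`; it is extended by `0`, which is immaterial as `w_b` vanishes off `R b`. -/
def composed {X : Type*} {B : ℕ} {R : Fin B → Set X} (w : Fin B → X → ℝ)
    (f : ∀ b, R b → ℝ) (x : X) : ℝ :=
  ∑ b, w b x * Function.extend (Subtype.val : R b → X) (f b) 0 x

/-- The composed predictor under `P`, where `S b` is the local statistical operator on the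
region `R b`. -/
def composedPredictor {X Y : Type*} [MeasurableSpace X] [MeasurableSpace Y] {B : ℕ}
    {R : Fin B → Set X} (w : Fin B → X → ℝ) (S : ∀ b, Measure (R b × Y) → R b → ℝ)
    (P : Measure (X × Y)) : X → ℝ :=
  composed w fun b => S b (regionalLaw P (R b))

/-- The composed predictor under contamination of `P` at `z` with weight `ε`: every region learns
from its contaminated regional law. -/
def contaminatedPredictor {X Y : Type*} [MeasurableSpace X] [MeasurableSpace Y] {B : ℕ}
    {R : Fin B → Set X} (w : Fin B → X → ℝ) (S : ∀ b, Measure (R b × Y) → R b → ℝ)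
    (P : Measure (X × Y)) (z : X × Y) (ε : ℝ) : X → ℝ :=
  composed w fun b => S b (contaminatedLaw P (R b) z ε)

/-- `G` is (a representative of) the influence function of the composed predictor at `z` for `P`:
the limit of `(contaminated predictor - predictor) / ε` in `L^∞(P^X)` as `ε` decreases to `0`. -/
def IsInfluenceFunction {X Y : Type*} [MeasurableSpace X] [MeasurableSpace Y] {B : ℕ}
    {R : Fin B → Set X} (w : Fin B → X → ℝ) (S : ∀ b, Measure (R b × Y) → R b → ℝ)
    (P : Measure (X × Y)) (z : X × Y) (G : X → ℝ) : Prop :=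
  MemLp G ∞ P.fst ∧
    Tendsto (fun ε : ℝ => eLpNorm (fun x =>
        (contaminatedPredictor w S P z ε x - composedPredictor w S P x) / ε - G x) ∞ P.fst)
      (𝓝[>] 0) (𝓝 0)

end LocalSVM

end

/-!
The support vector machine for a law `ν` is the zero of the gradient `T` of its regularized risk.
As the loss is convex, `T` is strongly monotone with constant `2λ`. Contaminating `ν` at `z` with
weight `ε` turns the equation `T f = 0` into `T f = ε V(f)` for a continuous `V` of norm at most
`2 ℓ κ`. Strong monotonicity first gives `f_ε → f₀`; then `ε⁻¹ (T f_ε - T f₀) → V(f₀)`, and the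
derivative of `T` at `f₀` is coercive, hence invertible by Lax–Milgram, so that
`ε⁻¹ (f_ε - f₀)` converges in the Hilbert space to a vector of norm at most `ℓ κ / λ`. By the
reproducing property this convergence is uniform on the region. Regions of mass zero, where the
local predictors are arbitrary, are invisible in `L^∞(P^X)`.
-/

namespace LocalSVM

section Hilbert

variable {H : Type*} [NormedAddCommGroup H] [InnerProductSpace ℝ H]

lemma norm_sub_sq_le_of_strongConvexOn {J : H → ℝ} {m c : ℝ} (hJ : StrongConvexOn univ m J)
    (hc : ∀ f, c ≤ J f) (f g : H) : m / 4 * ‖f - g‖ ^ 2 ≤ J f + J g - 2 * c := by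
  have hmid := hJ.2 (mem_univ f) (mem_univ g) (by norm_num : (0 : ℝ) ≤ 1 / 2)
    (by norm_num : (0 : ℝ) ≤ 1 / 2) (by norm_num)
  have hle := hc ((1 / 2 : ℝ) • f + (1 / 2 : ℝ) • g)
  simp only [smul_eq_mul] at hmid
  linarith

theorem existsUnique_forall_le_of_strongConvexOn [CompleteSpace H] {J : H → ℝ} {m : ℝ}
    (hm : 0 < m) (hJ : StrongConvexOn univ m J) (hcont : Continuous J)
    (hbdd : BddBelow (range J)) : ∃! f, ∀ g, J f ≤ J g := by
  obtain ⟨v, -, hv, hvJ⟩ := exists_seq_tendsto_sInf (range_nonempty J) hbdd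
  choose u hu using hvJ
  obtain rfl : (fun n => J (u n)) = v := funext hu
  rw [sInf_range] at hv
  have hgap : Tendsto (fun p : ℕ × ℕ => 4 / m * (J (u p.1) + J (u p.2) - 2 * iInf J))
      atTop (𝓝 0) := by
    rw [← prod_atTop_atTop_eq]
    simpa [← two_mul, Function.comp_def] using
      (((hv.comp tendsto_fst).add (hv.comp tendsto_snd)).sub_const (2 * iInf J)).const_mul (4 / m)
  have hcauchy : CauchySeq u := by
    rw [cauchySeq_iff_tendsto_dist_atTop_0]
    have hsq : Tendsto (fun p : ℕ × ℕ => dist (u p.1) (u p.2) ^ 2) atTop (𝓝 0) := by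
      refine squeeze_zero (fun _ => by positivity) (fun p => ?_) hgap
      rw [dist_eq_norm, div_mul_eq_mul_div, le_div_iff₀ hm]
      linarith [norm_sub_sq_le_of_strongConvexOn hJ (ciInf_le hbdd) (u p.1) (u p.2)]
    simpa [Real.sqrt_sq dist_nonneg] using hsq.sqrt
  obtain ⟨f, hf⟩ := cauchySeq_tendsto_of_complete hcauchy
  have hmin : J f = iInf J := tendsto_nhds_unique ((hcont.tendsto f).comp hf) hv
  have hconv : StrictConvexOn ℝ univ J := hJ.strictConvexOn hm
  refine ⟨f, fun g => hmin ▸ ciInf_le hbdd g, fun g hg => ?_⟩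
  exact hconv.eq_of_isMinOn (fun h _ => hg h) (fun h _ => hmin ▸ ciInf_le hbdd h) (mem_univ g)
    (mem_univ f)

lemma strongConvexOn_add_mul_norm_sq {φ : H → ℝ} (hφ : ConvexOn ℝ univ φ) (lam : ℝ) :
    StrongConvexOn univ (2 * lam) fun f => φ f + lam * ‖f‖ ^ 2 := by
  rw [strongConvexOn_iff_convex]
  convert hφ using 2
  ring

theorem existsUnique_forall_add_mul_norm_sq_le [CompleteSpace H] {φ : H → ℝ}
    (hφ : ConvexOn ℝ univ φ) {K : ℝ≥0} (hK : LipschitzWith K φ) {lam : ℝ} (hlam : 0 < lam) :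
    ∃! f, ∀ g, φ f + lam * ‖f‖ ^ 2 ≤ φ g + lam * ‖g‖ ^ 2 := by
  refine existsUnique_forall_le_of_strongConvexOn (mul_pos two_pos hlam)
    (strongConvexOn_add_mul_norm_sq hφ lam) (hK.continuous.add (by fun_prop))
    ⟨φ 0 - K ^ 2 / (4 * lam), ?_⟩
  rintro _ ⟨f, rfl⟩
  have hlip : φ 0 - φ f ≤ K * ‖f‖ := by
    simpa using (le_abs_self _).trans (hK.dist_le_mul 0 f)
  have hsq : K * ‖f‖ ≤ lam * ‖f‖ ^ 2 + K ^ 2 / (4 * lam) := by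
    have hexpand : lam * ‖f‖ ^ 2 + K ^ 2 / (4 * lam) - K * ‖f‖ =
        (2 * lam * ‖f‖ - K) ^ 2 / (4 * lam) := by
      field_simp
      ring
    have : 0 ≤ (2 * lam * ‖f‖ - K) ^ 2 / (4 * lam) := by positivity
    linarith
  linarith

/-- A strongly monotone operator on a Hilbert space with modulus `c`, for instance the gradient of
a strongly convex function. -/
def IsStronglyMonotone (c : ℝ) (T : H → H) : Prop :=
  ∀ f g, c * ‖f - g‖ ^ 2 ≤ inner ℝ (T f - T g) (f - g)

namespace IsStronglyMonotone

variable {c : ℝ} {T : H → H}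

lemma mul_norm_sub_le (hT : IsStronglyMonotone c T) (f g : H) :
    c * ‖f - g‖ ≤ ‖T f - T g‖ := by
  rcases eq_or_ne f g with rfl | hfg
  · simp
  · refine le_of_mul_le_mul_right ?_ (norm_sub_pos_iff.2 hfg)
    calc c * ‖f - g‖ * ‖f - g‖ = c * ‖f - g‖ ^ 2 := by ring
      _ ≤ inner ℝ (T f - T g) (f - g) := hT f g
      _ ≤ ‖T f - T g‖ * ‖f - g‖ := real_inner_le_norm _ _

lemma mul_norm_sq_le_inner_fderiv (hT : IsStronglyMonotone c T) {T' : H →L[ℝ] H} {f : H}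
    (hT' : HasFDerivAt T T' f) (h : H) : c * ‖h‖ ^ 2 ≤ inner ℝ (T' h) h := by
  have hslope : Tendsto (fun t : ℝ => inner ℝ (t⁻¹ • (T (f + t • h) - T f)) h) (𝓝[≠] 0)
      (𝓝 (inner ℝ (T' h) h)) :=
    (hT'.hasLineDerivAt h).tendsto_slope_zero.inner tendsto_const_nhds
  refine ge_of_tendsto hslope (eventually_mem_nhdsWithin.mono fun t (ht : t ≠ 0) => ?_)
  have ht2 : 0 < t ^ 2 := by positivity
  refine le_of_mul_le_mul_left ?_ ht2
  have := hT (f + t • h) f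
  rw [add_sub_cancel_left, norm_smul, mul_pow, Real.norm_eq_abs, sq_abs, inner_smul_right] at this
  rw [inner_smul_left]
  calc t ^ 2 * (c * ‖h‖ ^ 2) = c * (t ^ 2 * ‖h‖ ^ 2) := by ring
    _ ≤ t * inner ℝ (T (f + t • h) - T f) h := this
    _ = t ^ 2 * ((starRingEnd ℝ) t⁻¹ * inner ℝ (T (f + t • h) - T f) h) := by
      rw [conj_trivial]
      field_simp

lemma tendsto_of_tendsto_comp (hc : 0 < c) (hT : IsStronglyMonotone c T) {ι : Type*}
    {l : Filter ι} {f : ι → H} {f₀ : H} (h : Tendsto (fun i => T (f i)) l (𝓝 (T f₀))) :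
    Tendsto f l (𝓝 f₀) := by
  rw [tendsto_iff_norm_sub_tendsto_zero] at h ⊢
  refine squeeze_zero (fun _ => norm_nonneg _) (fun i => ?_) (by simpa using h.const_mul c⁻¹)
  exact (le_inv_mul_iff₀ hc).2 (hT.mul_norm_sub_le _ _)

variable [CompleteSpace H]

lemma exists_continuousLinearEquiv_eq_fderiv (hc : 0 < c) (hT : IsStronglyMonotone c T)
    {T' : H →L[ℝ] H} {f : H} (hT' : HasFDerivAt T T' f) :
    ∃ e : H ≃L[ℝ] H, (e : H →L[ℝ] H) = T' := by
  have hcoer : IsCoercive (innerSL ℝ ∘L T') := ⟨c, hc, fun h => by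
    rw [mul_assoc, ← pow_two]
    exact hT.mul_norm_sq_le_inner_fderiv hT' h⟩
  refine ⟨hcoer.continuousLinearEquivOfBilin, ?_⟩
  ext h
  exact ext_inner_right ℝ fun g => hcoer.continuousLinearEquivOfBilin_apply h g

/-- The inverse function theorem for a strongly monotone operator along a curve `f` that need not
be continuous a priori: if `T ∘ f` has the one-sided derivative `v` at `0`, then `f` has one. -/
theorem exists_tendsto_inv_smul_sub (hc : 0 < c) (hT : IsStronglyMonotone c T) {f₀ : H}
    (hd : DifferentiableAt ℝ T f₀) {f : ℝ → H} {v : H}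
    (hv : Tendsto (fun ε => ε⁻¹ • (T (f ε) - T f₀)) (𝓝[>] 0) (𝓝 v)) :
    ∃ g, c * ‖g‖ ≤ ‖v‖ ∧ Tendsto (fun ε => ε⁻¹ • (f ε - f₀)) (𝓝[>] 0) (𝓝 g) := by
  obtain ⟨e, he⟩ := hT.exists_continuousLinearEquiv_eq_fderiv hc hd.hasFDerivAt
  have hquot : ∀ ε, ‖ε⁻¹ • (f ε - f₀)‖ ≤ c⁻¹ * ‖ε⁻¹ • (T (f ε) - T f₀)‖ := fun ε => by
    rw [norm_smul, norm_smul, mul_left_comm, inv_mul_eq_div c]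
    gcongr
    rw [le_div_iff₀' hc]
    exact hT.mul_norm_sub_le _ _
  have hbdd : (fun ε => ε⁻¹ • (f ε - f₀)) =O[𝓝[>] 0] fun _ => (1 : ℝ) :=
    (Asymptotics.IsBigO.of_bound _ (.of_forall hquot)).trans (hv.isBigO_one ℝ)
  have hf : Tendsto f (𝓝[>] 0) (𝓝 f₀) := by
    refine hT.tendsto_of_tendsto_comp hc (tendsto_sub_nhds_zero_iff.1 ?_)
    have hsmul : Tendsto (fun ε : ℝ => ε • ε⁻¹ • (T (f ε) - T f₀)) (𝓝[>] 0) (𝓝 ((0 : ℝ) • v)) :=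
      (tendsto_id.mono_left nhdsWithin_le_nhds).smul hv
    rw [zero_smul] at hsmul
    refine hsmul.congr' (eventually_mem_nhdsWithin.mono fun ε (hε : 0 < ε) => ?_)
    rw [smul_inv_smul₀ hε.ne']
  have hrem : Tendsto (fun ε => ε⁻¹ • (T (f ε) - T f₀ - e (f ε - f₀))) (𝓝[>] 0) (𝓝 0) := by
    have hlittle := ((he ▸ hd.hasFDerivAt).isLittleO.comp_tendsto hf)
    have := ((Asymptotics.isBigO_refl (fun ε : ℝ => ε⁻¹) (𝓝[>] 0)).smul_isLittleO hlittle)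
    exact (Asymptotics.isLittleO_one_iff ℝ).1 (this.trans_isBigO hbdd)
  have hlim : Tendsto (fun ε => ε⁻¹ • (f ε - f₀)) (𝓝[>] 0) (𝓝 (e.symm v)) := by
    have := (e.symm.continuous.tendsto _).comp (hv.sub hrem)
    simpa [Function.comp_def, ← smul_sub] using this
  refine ⟨e.symm v, ?_, hlim⟩
  rw [← le_inv_mul_iff₀ hc]
  exact le_of_tendsto_of_tendsto' hlim.norm (hv.norm.const_mul _) hquot

end IsStronglyMonotone

end Hilbert

section Loss

variable {Y : Type*} [MeasurableSpace Y]

lemma measurable_uncurry_deriv {g : Y → ℝ → ℝ} (hg : Measurable (Function.uncurry g))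
    (hd : ∀ y, Differentiable ℝ (g y)) : Measurable (Function.uncurry fun y => deriv (g y)) := by
  have hstep : Tendsto (fun n : ℕ => 1 / ((n : ℝ) + 1)) atTop (𝓝[≠] 0) :=
    tendsto_nhdsWithin_iff.2 ⟨tendsto_one_div_add_atTop_nhds_zero_nat,
      .of_forall fun n => (Nat.one_div_pos_of_nat (α := ℝ)).ne'⟩
  refine measurable_of_tendsto_metrizable (f := fun (n : ℕ) (p : Y × ℝ) =>
    (1 / ((n : ℝ) + 1))⁻¹ • (g p.1 (p.2 + 1 / ((n : ℝ) + 1)) - g p.1 p.2)) (fun n => ?_)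
    (tendsto_pi_nhds.2 fun p => (hd p.1 p.2).hasDerivAt.tendsto_slope_zero.comp hstep)
  have hshift : Measurable fun p : Y × ℝ => g p.1 (p.2 + 1 / ((n : ℝ) + 1)) :=
    hg.comp (measurable_fst.prodMk (measurable_snd.add_const _))
  exact (hshift.sub hg).const_smul (1 / ((n : ℝ) + 1))⁻¹

/-- A measurable loss function that is convex and Lipschitz with constant `ℓ` in its last
argument. -/
structure IsConvexLipschitzLoss (L : Y → ℝ → ℝ) (ℓ : ℝ≥0) : Prop where
  measurable : Measurable (Function.uncurry L)
  convexOn : ∀ y, ConvexOn ℝ univ (L y)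
  lipschitzWith : ∀ y, LipschitzWith ℓ (L y)

/-- A convex Lipschitz loss function that is twice differentiable in its last argument, with second
derivative bounded by `M`. -/
structure IsSmoothLoss (L : Y → ℝ → ℝ) (ℓ : ℝ≥0) (M : ℝ) : Prop
    extends IsConvexLipschitzLoss L ℓ where
  differentiable : ∀ y, Differentiable ℝ (L y)
  differentiable_deriv : ∀ y, Differentiable ℝ (deriv (L y))
  abs_deriv_deriv_le : ∀ y t, |deriv (deriv (L y)) t| ≤ M

variable {L : Y → ℝ → ℝ} {ℓ : ℝ≥0} {M : ℝ}

namespace IsConvexLipschitzLoss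

variable (hL : IsConvexLipschitzLoss L ℓ)
include hL

lemma measurable_shiftedLoss : Measurable (Function.uncurry (shiftedLoss L)) :=
  hL.measurable.sub (hL.measurable.comp (measurable_fst.prodMk measurable_const))

lemma convexOn_shiftedLoss (y : Y) : ConvexOn ℝ univ (shiftedLoss L y) :=
  (hL.convexOn y).sub (concaveOn_const _ convex_univ)

lemma abs_shiftedLoss_le (y : Y) (t : ℝ) : |shiftedLoss L y t| ≤ ℓ * |t| := by
  simpa [shiftedLoss, Real.dist_eq] using (hL.lipschitzWith y).dist_le_mul t 0

lemma abs_deriv_le (y : Y) (t : ℝ) : |deriv (L y) t| ≤ ℓ :=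
  norm_deriv_le_of_lipschitz (hL.lipschitzWith y)

end IsConvexLipschitzLoss

namespace IsSmoothLoss

variable (hL : IsSmoothLoss L ℓ M)
include hL

lemma monotone_deriv (y : Y) : Monotone (deriv (L y)) :=
  monotoneOn_univ.1 <| interior_univ (X := ℝ) ▸ (hL.convexOn y).monotoneOn_deriv
    fun t _ => hL.differentiable y t

lemma measurable_deriv : Measurable (Function.uncurry fun y => deriv (L y)) :=
  measurable_uncurry_deriv hL.measurable hL.differentiable

end IsSmoothLoss

lemma IsConvexLipschitzLoss.exists_isSmoothLoss (hL : IsConvexLipschitzLoss L ℓ)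
    (hdiff : ∀ y, ContDiff ℝ 2 (L y))
    (hderiv2 : (⨆ y, ⨆ t, ‖iteratedDeriv 2 (L y) t‖ₑ) < ∞) : ∃ M, IsSmoothLoss L ℓ M := by
  refine ⟨(⨆ y, ⨆ t, ‖iteratedDeriv 2 (L y) t‖ₑ).toReal, hL,
    fun y => (hdiff y).differentiable two_ne_zero, fun y => (hdiff y).differentiable_deriv_two,
    fun y t => ?_⟩
  have hle : ‖iteratedDeriv 2 (L y) t‖ₑ ≤ ⨆ y, ⨆ t, ‖iteratedDeriv 2 (L y) t‖ₑ :=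
    le_iSup₂_of_le y t le_rfl
  rw [iteratedDeriv_succ, iteratedDeriv_one] at hle
  simpa using ENNReal.toReal_mono hderiv2.ne hle

end Loss

section KernelSection

lemma continuous_of_continuous_inner {E F : Type*} [TopologicalSpace E] [NormedAddCommGroup F]
    [InnerProductSpace ℝ F] {Φ : E → F} (h : Continuous fun p : E × E => inner ℝ (Φ p.1) (Φ p.2)) :
    Continuous Φ := by
  refine continuous_iff_continuousAt.2 fun x₀ => tendsto_iff_norm_sub_tendsto_zero.2 ?_
  have hdiag : Continuous fun x => inner ℝ (Φ x) (Φ x) :=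
    h.comp (continuous_id.prodMk continuous_id)
  have hslice : Continuous fun x => inner ℝ (Φ x) (Φ x₀) := h.comp (.prodMk_left x₀)
  have hnorm : ∀ x, ‖Φ x - Φ x₀‖ =
      √(inner ℝ (Φ x) (Φ x) - 2 * inner ℝ (Φ x) (Φ x₀) + inner ℝ (Φ x₀) (Φ x₀)) := fun x => by
    rw [real_inner_self_eq_norm_sq, real_inner_self_eq_norm_sq, ← norm_sub_sq_real,
      Real.sqrt_sq (norm_nonneg _)]
  have hcont : Continuous fun x => ‖Φ x - Φ x₀‖ := by
    simp_rw [hnorm]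
    fun_prop
  simpa using hcont.tendsto x₀

variable {E : Type*} {H : Type*} [NormedAddCommGroup H] [InnerProductSpace ℝ H]
  [CompleteSpace H] [RKHS ℝ H E ℝ]

variable (H) in
/-- The canonical feature map `x ↦ k(·, x)` of a real reproducing kernel Hilbert space. -/
noncomputable def kernelSection (x : E) : H :=
  RKHS.kerFun H x (1 : ℝ)

lemma inner_kernelSection (f : H) (x : E) : inner ℝ (kernelSection H x) f = f x := by
  simp [kernelSection]

lemma scalarKernel_eq_inner (x x' : E) :
    scalarKernel H x x' = inner ℝ (kernelSection H x) (kernelSection H x') := by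
  rw [scalarKernel, real_inner_comm, kernelSection, kernelSection, ← RKHS.kernel_inner]
  simp

lemma norm_kernelSection_le_kernelNorm
    (hk : BddAbove (range fun x : E => √(scalarKernel H x x))) (x : E) :
    ‖kernelSection H x‖ ≤ kernelNorm (E := E) H := by
  refine le_of_eq_of_le ?_ (le_ciSup hk x)
  rw [scalarKernel_eq_inner, real_inner_self_eq_norm_sq, Real.sqrt_sq (norm_nonneg _)]

lemma continuous_kernelSection [TopologicalSpace E]
    (hk : Continuous fun p : E × E => scalarKernel H p.1 p.2) :
    Continuous (kernelSection H : E → H) :=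
  continuous_of_continuous_inner (by simpa only [scalarKernel_eq_inner] using hk)

lemma norm_kerFun_eq_norm_kernelSection (x : E) : ‖RKHS.kerFun H x‖ = ‖kernelSection H x‖ := by
  rw [kernelSection, ← ContinuousLinearMap.norm_toSpanSingleton (𝕜 := ℝ) (RKHS.kerFun H x 1),
    ContinuousLinearMap.toSpanSingleton_apply_map_one]

lemma abs_apply_le {κ : ℝ} (hκ : ∀ x : E, ‖kernelSection H x‖ ≤ κ) (f : H) (x : E) :
    |f x| ≤ κ * ‖f‖ := by
  rw [← inner_kernelSection]
  exact (abs_real_inner_le_norm _ _).trans (mul_le_mul_of_nonneg_right (hκ x) (norm_nonneg f))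

lemma norm_deriv_smul_kernelSection_le {Y : Type*} [MeasurableSpace Y] {L : Y → ℝ → ℝ} {ℓ : ℝ≥0}
    (hL : IsConvexLipschitzLoss L ℓ) {κ : ℝ} (hκ : ∀ x : E, ‖kernelSection H x‖ ≤ κ) (f : H)
    (x : E) (y : Y) : ‖deriv (L y) (f x) • kernelSection H x‖ ≤ ℓ * κ := by
  rw [norm_smul]
  exact mul_le_mul (hL.abs_deriv_le _ _) (hκ x) (norm_nonneg _) ℓ.coe_nonneg

lemma measurable_coe_of_stronglyMeasurable_kernelSection [MeasurableSpace E]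
    (hk : StronglyMeasurable (kernelSection H : E → H)) (f : H) : Measurable f := by
  simp_rw [funext fun x => (inner_kernelSection f x).symm]
  exact (hk.inner stronglyMeasurable_const).measurable

end KernelSection

section Risk

variable {E Y H : Type*} [MeasurableSpace E] [MeasurableSpace Y]
  [NormedAddCommGroup H] [InnerProductSpace ℝ H] [CompleteSpace H] [RKHS ℝ H E ℝ]
  {L : Y → ℝ → ℝ} {ℓ : ℝ≥0} {M κ lam : ℝ} {ν : Measure (E × Y)}

lemma measurable_uncurry_comp {g : Y → ℝ → ℝ} (hg : Measurable (Function.uncurry g)) {f : E → ℝ}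
    (hf : Measurable f) : Measurable fun p : E × Y => g p.2 (f p.1) :=
  hg.comp (measurable_snd.prodMk (hf.comp measurable_fst))

section FiniteMeasure

variable [IsFiniteMeasure ν]

lemma integrable_shiftedLoss (hL : IsConvexLipschitzLoss L ℓ)
    (hk : StronglyMeasurable (kernelSection H : E → H)) (hκ : ∀ x : E, ‖kernelSection H x‖ ≤ κ)
    (f : H) : Integrable (fun p => shiftedLoss L p.2 (f p.1)) ν := by
  refine .of_bound (measurable_uncurry_comp hL.measurable_shiftedLoss
    (measurable_coe_of_stronglyMeasurable_kernelSection hk f)).aestronglyMeasurable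
    (ℓ * (κ * ‖f‖)) (.of_forall fun p => ?_)
  exact (hL.abs_shiftedLoss_le _ _).trans
    (mul_le_mul_of_nonneg_left (abs_apply_le hκ f p.1) ℓ.coe_nonneg)

lemma convexOn_integral_shiftedLoss (hL : IsConvexLipschitzLoss L ℓ)
    (hk : StronglyMeasurable (kernelSection H : E → H)) (hκ : ∀ x : E, ‖kernelSection H x‖ ≤ κ) :
    ConvexOn ℝ univ fun f : H => ∫ p, shiftedLoss L p.2 (f p.1) ∂ν := by
  have hint := integrable_shiftedLoss (ν := ν) hL hk hκ
  refine ⟨convex_univ, fun f _ g _ a b ha hb hab => ?_⟩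
  calc ∫ p, shiftedLoss L p.2 ((a • f + b • g : H) p.1) ∂ν
      ≤ ∫ p, a • shiftedLoss L p.2 (f p.1) + b • shiftedLoss L p.2 (g p.1) ∂ν := by
        refine integral_mono (hint _) (((hint f).smul a).add ((hint g).smul b)) fun p => ?_
        simpa using (hL.convexOn_shiftedLoss p.2).2 (mem_univ (f p.1)) (mem_univ (g p.1)) ha hb hab
    _ = a • (∫ p, shiftedLoss L p.2 (f p.1) ∂ν) + b • ∫ p, shiftedLoss L p.2 (g p.1) ∂ν := by
        rw [← integral_smul, ← integral_smul]
        exact integral_add ((hint f).smul a) ((hint g).smul b)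

lemma lipschitzWith_integral_shiftedLoss (hL : IsConvexLipschitzLoss L ℓ)
    (hk : StronglyMeasurable (kernelSection H : E → H)) (hκ : ∀ x : E, ‖kernelSection H x‖ ≤ κ) :
    LipschitzWith (ℓ * κ * ν.real univ).toNNReal
      fun f : H => ∫ p, shiftedLoss L p.2 (f p.1) ∂ν := by
  have hint := integrable_shiftedLoss (ν := ν) hL hk hκ
  refine .of_dist_le' fun f g => ?_
  rw [dist_eq_norm, dist_eq_norm, ← integral_sub (hint f) (hint g), mul_right_comm]
  refine norm_integral_le_of_norm_le_const (.of_forall fun p => ?_)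
  calc ‖shiftedLoss L p.2 (f p.1) - shiftedLoss L p.2 (g p.1)‖ ≤ ℓ * |(f - g) p.1| := by
        simpa [shiftedLoss, Real.dist_eq] using (hL.lipschitzWith p.2).dist_le_mul (f p.1) (g p.1)
    _ ≤ ℓ * (κ * ‖f - g‖) :=
        mul_le_mul_of_nonneg_left (abs_apply_le hκ (f - g) p.1) ℓ.coe_nonneg
    _ = ℓ * κ * ‖f - g‖ := by ring

theorem existsUnique_isSVM (hL : IsConvexLipschitzLoss L ℓ)
    (hk : StronglyMeasurable (kernelSection H : E → H)) (hκ : ∀ x : E, ‖kernelSection H x‖ ≤ κ)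
    (hlam : 0 < lam) : ∃! f : H, IsSVM L lam ν f :=
  existsUnique_forall_add_mul_norm_sq_le (convexOn_integral_shiftedLoss hL hk hκ)
    (lipschitzWith_integral_shiftedLoss hL hk hκ) hlam

/-- Differentiation under the integral sign: since `f x = ⟪k_x, f⟫`, the chain rule contributes the
kernel section `k_x`. -/
lemma hasFDerivAt_integral_smul {F : Type*} [NormedAddCommGroup F] [NormedSpace ℝ F]
    {φ : Y → ℝ → ℝ} (hφ : Measurable (Function.uncurry φ)) (hd : ∀ y, Differentiable ℝ (φ y))
    {C K : ℝ} (hC : ∀ y t, |deriv (φ y) t| ≤ C) {Φ : E → F} (hΦ : StronglyMeasurable Φ)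
    (hΦK : ∀ x, ‖Φ x‖ ≤ K) (hk : StronglyMeasurable (kernelSection H : E → H))
    (hκ : ∀ x : E, ‖kernelSection H x‖ ≤ κ) {f : H}
    (hint : Integrable (fun p => φ p.2 (f p.1) • Φ p.1) ν) :
    HasFDerivAt (fun f : H => ∫ p, φ p.2 (f p.1) • Φ p.1 ∂ν)
      (∫ p, deriv (φ p.2) (f p.1) • (innerSL ℝ (kernelSection H p.1)).smulRight (Φ p.1) ∂ν) f := by
  have hmeas := measurable_coe_of_stronglyMeasurable_kernelSection hk
  have hΦ₁ : StronglyMeasurable fun p : E × Y => Φ p.1 := hΦ.comp_measurable measurable_fst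
  have hk₁ : StronglyMeasurable fun p : E × Y => kernelSection H p.1 :=
    hk.comp_measurable measurable_fst
  have hright : StronglyMeasurable fun p : E × Y =>
      (innerSL ℝ (kernelSection H p.1)).smulRight (Φ p.1) :=
    (ContinuousLinearMap.smulRightL ℝ H F).continuous₂.comp_stronglyMeasurable
      (((innerSL ℝ).continuous.comp_stronglyMeasurable hk₁).prodMk hΦ₁)
  refine hasFDerivAt_integral_of_dominated_of_fderiv_le (bound := fun _ => C * (κ * K))
    (F' := fun f p => deriv (φ p.2) (f p.1) • (innerSL ℝ (kernelSection H p.1)).smulRight (Φ p.1))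
    univ_mem
    (.of_forall fun g => ((measurable_uncurry_comp hφ (hmeas g)).stronglyMeasurable.smul
      hΦ₁).aestronglyMeasurable) hint
    ((measurable_uncurry_comp (measurable_uncurry_deriv hφ hd)
      (hmeas f)).stronglyMeasurable.smul hright).aestronglyMeasurable
    (.of_forall fun p g _ => ?_) (integrable_const _) (.of_forall fun p g _ => ?_)
  · rw [norm_smul, ContinuousLinearMap.norm_smulRight_apply, innerSL_apply_norm]
    have hκ0 := (norm_nonneg _).trans (hκ p.1)
    have hC0 := (abs_nonneg _).trans (hC p.2 0)
    gcongr
    exacts [hC _ _, hκ _, hΦK _]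
  · have heval : HasFDerivAt (fun g : H => g p.1) (innerSL ℝ (kernelSection H p.1)) g := by
      refine (innerSL ℝ (kernelSection H p.1)).hasFDerivAt.congr_of_eventuallyEq ?_
      exact .of_forall fun h => (inner_kernelSection h p.1).symm
    refine (((hd p.2 (g p.1)).hasDerivAt.comp_hasFDerivAt g heval).smul_const
      (Φ p.1)).congr_fderiv ?_
    ext h
    simp [mul_smul]

end FiniteMeasure

/-- The gradient of the risk `f ↦ ∫ L*(y, f(x)) dν(x, y)` for a differentiable loss, namely the
Bochner integral of `L'(y, f(x)) k_x`. -/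
noncomputable def riskGradient (L : Y → ℝ → ℝ) (ν : Measure (E × Y)) (f : H) : H :=
  ∫ p, deriv (L p.2) (f p.1) • kernelSection H p.1 ∂ν

/-- The gradient of the regularized risk. -/
noncomputable def regRiskGradient (L : Y → ℝ → ℝ) (lam : ℝ) (ν : Measure (E × Y)) (f : H) : H :=
  riskGradient L ν f + (2 * lam) • f

lemma norm_riskGradient_le [IsProbabilityMeasure ν] (hL : IsConvexLipschitzLoss L ℓ)
    (hκ : ∀ x : E, ‖kernelSection H x‖ ≤ κ) (f : H) : ‖riskGradient L ν f‖ ≤ ℓ * κ := by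
  simpa [riskGradient] using norm_integral_le_of_norm_le_const (μ := ν)
    (.of_forall fun p => norm_deriv_smul_kernelSection_le hL hκ f p.1 p.2)

lemma stronglyMeasurable_deriv_smul_kernelSection (hL : IsSmoothLoss L ℓ M)
    (hk : StronglyMeasurable (kernelSection H : E → H)) (f : H) :
    StronglyMeasurable fun p : E × Y => deriv (L p.2) (f p.1) • kernelSection H p.1 :=
  (measurable_uncurry_comp hL.measurable_deriv
    (measurable_coe_of_stronglyMeasurable_kernelSection hk f)).stronglyMeasurable.smul
    (hk.comp_measurable measurable_fst)

variable [IsFiniteMeasure ν]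

lemma integrable_deriv_smul_kernelSection (hL : IsSmoothLoss L ℓ M)
    (hk : StronglyMeasurable (kernelSection H : E → H)) (hκ : ∀ x : E, ‖kernelSection H x‖ ≤ κ)
    (f : H) : Integrable (fun p => deriv (L p.2) (f p.1) • kernelSection H p.1) ν :=
  .of_bound (stronglyMeasurable_deriv_smul_kernelSection hL hk f).aestronglyMeasurable (ℓ * κ)
    (.of_forall fun p =>
      norm_deriv_smul_kernelSection_le hL.toIsConvexLipschitzLoss hκ f p.1 p.2)

lemma differentiable_riskGradient (hL : IsSmoothLoss L ℓ M)
    (hk : StronglyMeasurable (kernelSection H : E → H)) (hκ : ∀ x : E, ‖kernelSection H x‖ ≤ κ) :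
    Differentiable ℝ (riskGradient L ν : H → H) := fun f =>
  (hasFDerivAt_integral_smul hL.measurable_deriv hL.differentiable_deriv hL.abs_deriv_deriv_le
    hk hκ hk hκ (integrable_deriv_smul_kernelSection hL hk hκ f)).differentiableAt

lemma differentiable_regRiskGradient (hL : IsSmoothLoss L ℓ M)
    (hk : StronglyMeasurable (kernelSection H : E → H)) (hκ : ∀ x : E, ‖kernelSection H x‖ ≤ κ) :
    Differentiable ℝ (regRiskGradient L lam ν : H → H) :=
  (differentiable_riskGradient hL hk hκ).add (differentiable_id.const_smul _)

lemma hasGradientAt_integral_shiftedLoss (hL : IsSmoothLoss L ℓ M)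
    (hk : StronglyMeasurable (kernelSection H : E → H)) (hκ : ∀ x : E, ‖kernelSection H x‖ ≤ κ)
    (f : H) : HasGradientAt (fun f : H => ∫ p, shiftedLoss L p.2 (f p.1) ∂ν)
      (riskGradient L ν f) f := by
  have hderiv : ∀ y, deriv (shiftedLoss L y) = deriv (L y) := fun y => deriv_sub_const_fun _
  have hfderiv := hasFDerivAt_integral_smul (ν := ν) (f := f) (K := 1) (Φ := fun _ => (1 : ℝ))
    hL.measurable_shiftedLoss (fun y => (hL.differentiable y).sub_const _)
    (fun y t => hderiv y ▸ hL.abs_deriv_le y t) stronglyMeasurable_const (by simp) hk hκ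
    (by simpa using integrable_shiftedLoss hL.toIsConvexLipschitzLoss hk hκ f)
  simp only [hderiv, smul_eq_mul, mul_one] at hfderiv
  refine hfderiv.congr_fderiv ?_
  refine Eq.trans (integral_congr_ae (.of_forall fun p => ?_)) <|
    (innerSL ℝ : H →L[ℝ] H →L[ℝ] ℝ).integral_comp_comm
      (integrable_deriv_smul_kernelSection (ν := ν) hL hk hκ f)
  ext h
  change _ = inner ℝ (deriv (L p.2) (f p.1) • kernelSection H p.1) h
  simp [real_inner_smul_left]

lemma hasGradientAt_regRisk (hL : IsSmoothLoss L ℓ M)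
    (hk : StronglyMeasurable (kernelSection H : E → H)) (hκ : ∀ x : E, ‖kernelSection H x‖ ≤ κ)
    (f : H) : HasGradientAt (regRisk L lam ν) (regRiskGradient L lam ν f) f := by
  have hsq := ((hasStrictFDerivAt_norm_sq f).hasFDerivAt).const_mul lam
  refine ((hasGradientAt_integral_shiftedLoss hL hk hκ f).hasFDerivAt.add hsq).congr_fderiv ?_
  ext h
  simp only [regRiskGradient, add_apply, smul_apply, coe_innerSL_apply, nsmul_eq_mul,
    InnerProductSpace.toDual_apply_apply, Nat.cast_ofNat, smul_eq_mul, map_add, map_smul]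
  ring

lemma IsSVM.regRiskGradient_eq_zero (hL : IsSmoothLoss L ℓ M)
    (hk : StronglyMeasurable (kernelSection H : E → H)) (hκ : ∀ x : E, ‖kernelSection H x‖ ≤ κ)
    {f : H} (hf : IsSVM L lam ν f) : regRiskGradient L lam ν f = 0 := by
  have hmin : IsLocalMin (regRisk L lam ν) f := .of_forall hf
  simpa using hmin.hasFDerivAt_eq_zero (hasGradientAt_regRisk hL hk hκ f).hasFDerivAt

lemma isStronglyMonotone_regRiskGradient (hL : IsSmoothLoss L ℓ M)
    (hk : StronglyMeasurable (kernelSection H : E → H)) (hκ : ∀ x : E, ‖kernelSection H x‖ ≤ κ) :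
    IsStronglyMonotone (2 * lam) (regRiskGradient L lam ν : H → H) := fun f g => by
  have hint := integrable_deriv_smul_kernelSection (ν := ν) hL hk hκ
  have hmono : 0 ≤ inner ℝ (riskGradient L ν f - riskGradient L ν g) (f - g) := by
    rw [riskGradient, riskGradient, ← integral_sub (hint f) (hint g), real_inner_comm,
      ← integral_inner (f := fun p => _ - _) ((hint f).sub (hint g))]
    refine integral_nonneg fun p => ?_
    rw [real_inner_comm, ← sub_smul, real_inner_smul_left, inner_kernelSection, RKHS.coe_sub]
    exact ((hL.monotone_deriv p.2).monovary monotone_id).sub_mul_sub_nonneg _ _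
  rw [regRiskGradient, regRiskGradient, add_sub_add_comm, ← smul_sub, inner_add_left,
    real_inner_smul_left, real_inner_self_eq_norm_sq]
  linarith

end Risk

section Mixture

/-- The contamination mixture `(1 - ε) ν + ε δ_a`. -/
noncomputable def mixture {α : Type*} [MeasurableSpace α] (ν : Measure α) (a : α) (ε : ℝ) :
    Measure α :=
  ENNReal.ofReal (1 - ε) • ν + ENNReal.ofReal ε • Measure.dirac a

lemma isProbabilityMeasure_mixture {α : Type*} [MeasurableSpace α] (ν : Measure α)
    [IsProbabilityMeasure ν] (a : α) {ε : ℝ} (hε : ε ∈ Icc (0 : ℝ) 1) :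
    IsProbabilityMeasure (mixture ν a ε) := by
  constructor
  simp [mixture, ← ENNReal.ofReal_add (sub_nonneg.2 hε.2) hε.1]

lemma integral_mixture {α F : Type*} [MeasurableSpace α] [NormedAddCommGroup F] [NormedSpace ℝ F]
    [CompleteSpace F] {ν : Measure α} (a : α) {ε : ℝ} (hε : ε ∈ Icc (0 : ℝ) 1) {φ : α → F}
    (hφ : StronglyMeasurable φ) (hint : Integrable φ ν) :
    ∫ x, φ x ∂mixture ν a ε = (1 - ε) • (∫ x, φ x ∂ν) + ε • φ a := by
  rw [mixture, integral_add_measure (hint.smul_measure ENNReal.ofReal_ne_top)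
    ((integrable_dirac' hφ (by simp)).smul_measure ENNReal.ofReal_ne_top),
    integral_smul_measure, integral_smul_measure, integral_dirac' φ a hφ,
    ENNReal.toReal_ofReal (sub_nonneg.2 hε.2), ENNReal.toReal_ofReal hε.1]

variable {E Y H : Type*} [MeasurableSpace E] [MeasurableSpace Y]
  [NormedAddCommGroup H] [InnerProductSpace ℝ H] [CompleteSpace H] [RKHS ℝ H E ℝ]
  {L : Y → ℝ → ℝ} {ℓ : ℝ≥0} {M κ lam : ℝ} {ν : Measure (E × Y)} [IsProbabilityMeasure ν]
  {z : E × Y}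

/-- The direction `∇R(f) - L'(y, f(x)) k(x, ·)` by which contaminating `ν` at `z = (x, y)` displaces
the gradient of the risk `R`; it is the difference of the gradients under `ν` and under `δ_z`. -/
noncomputable def contaminationGradient (L : Y → ℝ → ℝ) (ν : Measure (E × Y)) (z : E × Y) (f : H) :
    H :=
  riskGradient L ν f - deriv (L z.2) (f z.1) • kernelSection H z.1

lemma norm_contaminationGradient_le (hL : IsConvexLipschitzLoss L ℓ)
    (hκ : ∀ x : E, ‖kernelSection H x‖ ≤ κ) (f : H) :
    ‖contaminationGradient L ν z f‖ ≤ 2 * (ℓ * κ) := by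
  rw [two_mul]
  exact (norm_sub_le _ _).trans (add_le_add (norm_riskGradient_le hL hκ f)
    (norm_deriv_smul_kernelSection_le hL hκ f z.1 z.2))

lemma continuous_contaminationGradient (hL : IsSmoothLoss L ℓ M)
    (hk : StronglyMeasurable (kernelSection H : E → H)) (hκ : ∀ x : E, ‖kernelSection H x‖ ≤ κ) :
    Continuous (contaminationGradient L ν z : H → H) := by
  have heval : Continuous fun f : H => f z.1 := by
    simp_rw [← inner_kernelSection]
    fun_prop
  exact (differentiable_riskGradient hL hk hκ).continuous.sub
    (((hL.differentiable_deriv z.2).continuous.comp heval).smul continuous_const)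

lemma regRiskGradient_mixture (hL : IsSmoothLoss L ℓ M)
    (hk : StronglyMeasurable (kernelSection H : E → H)) (hκ : ∀ x : E, ‖kernelSection H x‖ ≤ κ)
    {ε : ℝ} (hε : ε ∈ Icc (0 : ℝ) 1) (f : H) :
    regRiskGradient L lam (mixture ν z ε) f =
      regRiskGradient L lam ν f - ε • contaminationGradient L ν z f := by
  rw [regRiskGradient, regRiskGradient, contaminationGradient, riskGradient, integral_mixture z hε
    (stronglyMeasurable_deriv_smul_kernelSection hL hk f)
    (integrable_deriv_smul_kernelSection hL hk hκ f), ← riskGradient]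
  module

lemma IsSVM.regRiskGradient_eq_smul_contaminationGradient (hL : IsSmoothLoss L ℓ M)
    (hk : StronglyMeasurable (kernelSection H : E → H)) (hκ : ∀ x : E, ‖kernelSection H x‖ ≤ κ)
    {ε : ℝ} (hε : ε ∈ Icc (0 : ℝ) 1) {f : H} (hf : IsSVM L lam (mixture ν z ε) f) :
    regRiskGradient L lam ν f = ε • contaminationGradient L ν z f := by
  have := isProbabilityMeasure_mixture ν z hε
  rw [← sub_eq_zero, ← regRiskGradient_mixture hL hk hκ hε]
  exact hf.regRiskGradient_eq_zero hL hk hκ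

theorem exists_tendsto_inv_smul_sub_of_isSVM_mixture (hL : IsSmoothLoss L ℓ M)
    (hk : StronglyMeasurable (kernelSection H : E → H)) (hκ : ∀ x : E, ‖kernelSection H x‖ ≤ κ)
    (hlam : 0 < lam) {f₀ : H} (hf₀ : IsSVM L lam ν f₀) {f : ℝ → H}
    (hf : ∀ ε ∈ Ioc (0 : ℝ) 1, IsSVM L lam (mixture ν z ε) (f ε)) :
    ∃ g, ‖g‖ ≤ ℓ * κ / lam ∧ Tendsto (fun ε => ε⁻¹ • (f ε - f₀)) (𝓝[>] 0) (𝓝 g) := by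
  set T : H → H := regRiskGradient L lam ν
  set V : H → H := contaminationGradient L ν z
  have hT₀ : T f₀ = 0 := hf₀.regRiskGradient_eq_zero hL hk hκ
  have hTV : (fun ε => T (f ε)) =ᶠ[𝓝[>] 0] fun ε => ε • V (f ε) := by
    filter_upwards [Ioc_mem_nhdsGT one_pos] with ε hε
    exact (hf ε hε).regRiskGradient_eq_smul_contaminationGradient hL hk hκ ⟨hε.1.le, hε.2⟩
  have hT : IsStronglyMonotone (2 * lam) T := isStronglyMonotone_regRiskGradient hL hk hκ
  have hc : 0 < 2 * lam := mul_pos two_pos hlam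
  have hVle : ∀ f, ‖V f‖ ≤ 2 * (ℓ * κ) :=
    norm_contaminationGradient_le hL.toIsConvexLipschitzLoss hκ
  have hTf : Tendsto (fun ε => T (f ε)) (𝓝[>] 0) (𝓝 (T f₀)) := by
    rw [hT₀]
    exact Tendsto.congr' hTV.symm <|
      (tendsto_id.mono_left nhdsWithin_le_nhds).zero_smul_isBoundedUnder_le
        (isBoundedUnder_of ⟨2 * (ℓ * κ), fun ε => hVle (f ε)⟩)
  have hquot : Tendsto (fun ε => ε⁻¹ • (T (f ε) - T f₀)) (𝓝[>] 0) (𝓝 (V f₀)) := by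
    refine (((continuous_contaminationGradient hL hk hκ).tendsto f₀).comp
      (hT.tendsto_of_tendsto_comp hc hTf)).congr' ?_
    filter_upwards [hTV, self_mem_nhdsWithin] with ε hε (hpos : 0 < ε)
    rw [hT₀, sub_zero, hε, inv_smul_smul₀ hpos.ne', Function.comp_apply]
  obtain ⟨g, hg, hlim⟩ := hT.exists_tendsto_inv_smul_sub hc
    (differentiable_regRiskGradient hL hk hκ f₀) hquot
  refine ⟨g, ?_, hlim⟩
  rw [le_div_iff₀' hlam]
  linarith [hVle f₀]

end Mixture

section LocalPredictor

variable {E Y H : Type*} [MeasurableSpace E] [MeasurableSpace Y]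
  [NormedAddCommGroup H] [InnerProductSpace ℝ H] [CompleteSpace H] [RKHS ℝ H E ℝ]
  {L : Y → ℝ → ℝ} {ℓ : ℝ≥0} {M κ lam : ℝ}
  {ν : Measure (E × Y)} {f : E → ℝ}

lemma IsLocalPredictor.measurable (hk : StronglyMeasurable (kernelSection H : E → H))
    (hf : IsLocalPredictor H L lam ν f) : Measurable f := by
  by_cases hν : IsProbabilityMeasure ν
  · obtain ⟨h, -, rfl⟩ := hf.1 hν
    exact measurable_coe_of_stronglyMeasurable_kernelSection hk h
  · exact hf.2 hν

lemma IsLocalPredictor.exists_abs_le [IsProbabilityMeasure ν]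
    (hκ : ∀ x : E, ‖kernelSection H x‖ ≤ κ) (hf : IsLocalPredictor H L lam ν f) :
    ∃ C, ∀ x, |f x| ≤ C := by
  obtain ⟨h, -, rfl⟩ := hf.1 ‹_›
  exact ⟨κ * ‖h‖, abs_apply_le hκ h⟩

theorem exists_tendstoUniformly_of_isLocalPredictor_mixture [IsProbabilityMeasure ν] {z : E × Y}
    (hL : IsSmoothLoss L ℓ M) (hk : StronglyMeasurable (kernelSection H : E → H))
    (hκ : ∀ x : E, ‖kernelSection H x‖ ≤ κ) (hlam : 0 < lam) {s₀ : E → ℝ}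
    (hs₀ : IsLocalPredictor H L lam ν s₀) {s : ℝ → E → ℝ}
    (hs : ∀ ε ∈ Ioc (0 : ℝ) 1, IsLocalPredictor H L lam (mixture ν z ε) (s ε)) :
    ∃ g : H, ‖g‖ ≤ ℓ * κ / lam ∧
      TendstoUniformly (fun ε x => (s ε x - s₀ x) / ε) g (𝓝[>] 0) := by
  obtain ⟨f₀, hf₀, rfl⟩ := hs₀.1 ‹_›
  choose! f hf using fun ε (hε : ε ∈ Ioc (0 : ℝ) 1) =>
    (hs ε hε).1 (isProbabilityMeasure_mixture ν z ⟨hε.1.le, hε.2⟩)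
  obtain ⟨g, hg, hlim⟩ := exists_tendsto_inv_smul_sub_of_isSVM_mixture hL hk hκ hlam hf₀
    fun ε hε => (hf ε hε).1
  have hunif := RKHS.tendstoUniformly_of_norm_kerFun_le
    (fun x => (norm_kerFun_eq_norm_kernelSection x).trans_le (hκ x)) hlim
  refine ⟨g, hg, fun u hu => ?_⟩
  filter_upwards [hunif u hu, Ioc_mem_nhdsGT one_pos] with ε hεu hε x
  simpa [(hf ε hε).2, div_eq_inv_mul] using hεu x

end LocalPredictor

section Region

variable {X Y : Type*} [MeasurableSpace X] [MeasurableSpace Y] {P : Measure (X × Y)} {R : Set X}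
  {z : X × Y}

lemma isProbabilityMeasure_regionalLaw [IsFiniteMeasure P] (hR : MeasurableSet R)
    (hP : P.fst R ≠ 0) : IsProbabilityMeasure (regionalLaw P R) := by
  rw [Measure.fst_apply hR, ← prod_univ] at hP
  have hemb : MeasurableEmbedding (Prod.map (Subtype.val : R → X) (id : Y → Y)) :=
    (MeasurableEmbedding.subtype_coe hR).prodMap .id
  constructor
  rw [regionalLaw, if_pos (pos_iff_ne_zero.2 hP), Measure.smul_apply, hemb.comap_apply, image_univ,
    range_prodMap, Subtype.range_coe, range_id, smul_eq_mul,
    ENNReal.inv_mul_cancel hP (measure_ne_top _ _)]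

lemma contaminatedLaw_of_mem (hz : z.1 ∈ R) (ε : ℝ) :
    contaminatedLaw P R z ε = mixture (regionalLaw P R) (⟨z.1, hz⟩, z.2) ε :=
  dif_pos hz

lemma contaminatedLaw_of_notMem (hz : z.1 ∉ R) (ε : ℝ) :
    contaminatedLaw P R z ε = regionalLaw P R :=
  dif_neg hz

lemma isProbabilityMeasure_contaminatedLaw [IsFiniteMeasure P] (hR : MeasurableSet R)
    (hP : P.fst R ≠ 0) (z : X × Y) {ε : ℝ} (hε : ε ∈ Icc (0 : ℝ) 1) :
    IsProbabilityMeasure (contaminatedLaw P R z ε) := by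
  have := isProbabilityMeasure_regionalLaw hR hP
  by_cases hz : z.1 ∈ R
  · rw [contaminatedLaw_of_mem hz]
    exact isProbabilityMeasure_mixture _ _ hε
  · rwa [contaminatedLaw_of_notMem hz]

variable {H : Type*} [NormedAddCommGroup H] [InnerProductSpace ℝ H] [CompleteSpace H]
  [RKHS ℝ H R ℝ] {L : Y → ℝ → ℝ} {ℓ : ℝ≥0} {M κ lam : ℝ}

theorem exists_tendstoUniformly_regional [IsFiniteMeasure P] (hR : MeasurableSet R)
    (hL : IsSmoothLoss L ℓ M) (hk : StronglyMeasurable (kernelSection H : R → H))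
    (hκ : ∀ x : R, ‖kernelSection H x‖ ≤ κ) (hlam : 0 < lam) {S : Measure (R × Y) → R → ℝ}
    (hS : ∀ ν, IsLocalPredictor H L lam ν (S ν)) (hP : P.fst R ≠ 0) (z : X × Y) :
    ∃ G : R → ℝ, Measurable G ∧ (∀ x, |G x| ≤ ℓ * κ ^ 2 / lam) ∧
      TendstoUniformly (fun ε x => (S (contaminatedLaw P R z ε) x - S (regionalLaw P R) x) / ε) G
        (𝓝[>] 0) := by
  have := isProbabilityMeasure_regionalLaw hR hP
  by_cases hz : z.1 ∈ R
  · obtain ⟨g, hg, hlim⟩ := exists_tendstoUniformly_of_isLocalPredictor_mixture hL hk hκ hlam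
      (hS _) fun ε _ => hS (mixture (regionalLaw P R) (⟨z.1, hz⟩, z.2) ε)
    refine ⟨g, measurable_coe_of_stronglyMeasurable_kernelSection hk g, fun x => ?_, ?_⟩
    · have hκ0 : 0 ≤ κ := (norm_nonneg _).trans (hκ x)
      calc |g x| ≤ κ * ‖g‖ := abs_apply_le hκ g x
        _ ≤ κ * (ℓ * κ / lam) := by gcongr
        _ = ℓ * κ ^ 2 / lam := by ring
    · simpa only [contaminatedLaw_of_mem hz] using hlim
  · refine ⟨fun _ => 0, measurable_const, fun x => ?_, ?_⟩
    · rw [abs_zero]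
      positivity
    · simpa [contaminatedLaw_of_notMem hz] using
        (tendsto_const_nhds (x := (0 : ℝ))).tendstoUniformly_const

end Region

section Composition

variable {X : Type*} {B : ℕ} {R : Fin B → Set X} {w : Fin B → X → ℝ}

lemma composed_sub (f g : ∀ b, R b → ℝ) (x : X) :
    composed w f x - composed w g x = composed w (fun b x => f b x - g b x) x := by
  rw [composed, composed, composed, ← Finset.sum_sub_distrib]
  refine Finset.sum_congr rfl fun b _ => ?_
  rw [← mul_sub, ← Pi.sub_apply, ← Function.extend_sub, sub_zero]
  rfl

lemma composed_div (f : ∀ b, R b → ℝ) (c : ℝ) (x : X) :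
    composed w f x / c = composed w (fun b x => f b x / c) x := by
  rw [composed, composed, Finset.sum_div]
  refine Finset.sum_congr rfl fun b _ => ?_
  by_cases hx : x ∈ R b
  · lift x to R b using hx
    rw [Subtype.val_injective.extend_apply, Subtype.val_injective.extend_apply, mul_div_assoc]
  · have hx' : ¬∃ a : R b, (a : X) = x := by simpa using hx
    simp [Function.extend_apply' _ _ _ hx']

variable [MeasurableSpace X] {μ : Measure X}

lemma measurable_composed (hR : ∀ b, MeasurableSet (R b)) (hw : ∀ b, Measurable (w b))
    {f : ∀ b, R b → ℝ} (hf : ∀ b, Measurable (f b)) : Measurable (composed w f) :=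
  Finset.measurable_fun_sum _ fun b _ => (hw b).mul
    ((MeasurableEmbedding.subtype_coe (hR b)).measurable_extend (hf b) measurable_const)

lemma ae_forall_mem_imp_measure_ne_zero {ι : Type*} [Countable ι] (μ : Measure X)
    (R : ι → Set X) : ∀ᵐ x ∂μ, ∀ b, x ∈ R b → μ (R b) ≠ 0 := by
  refine ae_all_iff.2 fun b => ?_
  by_cases h : μ (R b) = 0
  · filter_upwards [measure_eq_zero_iff_ae_notMem.1 h] with x hx hx'
    exact absurd hx' hx
  · exact .of_forall fun _ _ => h

lemma eLpNorm_top_composed_le (hw : ∀ b, BddAbove (range fun x : R b => |w b x|))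
    {f : ∀ b, R b → ℝ} {C : Fin B → ℝ} (hC : ∀ b, 0 ≤ C b)
    (hf : ∀ b, μ (R b) ≠ 0 → ∀ x, |f b x| ≤ C b) :
    eLpNorm (composed w f) ∞ μ ≤ ENNReal.ofReal (∑ b, (⨆ x : R b, |w b x|) * C b) := by
  rw [eLpNorm_exponent_top]
  refine eLpNormEssSup_le_of_ae_bound ?_
  filter_upwards [ae_forall_mem_imp_measure_ne_zero μ R] with x hx
  refine (Finset.abs_sum_le_sum_abs _ _).trans (Finset.sum_le_sum fun b _ => ?_)
  have hsup : 0 ≤ ⨆ x : R b, |w b x| := Real.iSup_nonneg fun _ => abs_nonneg _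
  by_cases hxb : x ∈ R b
  · have hxμ := hx b hxb
    lift x to R b using hxb
    rw [Subtype.val_injective.extend_apply, abs_mul]
    exact mul_le_mul (le_ciSup (hw b) x) (hf b hxμ x) (abs_nonneg _) hsup
  · rw [Function.extend_apply' _ _ _ (by simpa using hxb), Pi.zero_apply, mul_zero, abs_zero]
    exact mul_nonneg hsup (hC b)

lemma memLp_top_composed (hR : ∀ b, MeasurableSet (R b)) (hw : ∀ b, Measurable (w b))
    (hw_bdd : ∀ b, BddAbove (range fun x : R b => |w b x|)) {f : ∀ b, R b → ℝ}
    (hf : ∀ b, Measurable (f b)) (hf_bdd : ∀ b, μ (R b) ≠ 0 → ∃ C, ∀ x, |f b x| ≤ C) :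
    MemLp (composed w f) ∞ μ := by
  choose! C hC using hf_bdd
  exact ⟨(measurable_composed hR hw hf).aestronglyMeasurable,
    (eLpNorm_top_composed_le hw_bdd (fun b => abs_nonneg (C b))
      fun b hb x => (hC b hb x).trans (le_abs_self _)).trans_lt ENNReal.ofReal_lt_top⟩

lemma tendsto_eLpNorm_top_composed_sub (hw : ∀ b, BddAbove (range fun x : R b => |w b x|))
    {ι : Type*} {l : Filter ι} {F : ι → ∀ b, R b → ℝ} {f : ∀ b, R b → ℝ}
    (hF : ∀ b, μ (R b) ≠ 0 → TendstoUniformly (fun i => F i b) (f b) l) :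
    Tendsto (fun i => eLpNorm (fun x => composed w (F i) x - composed w f x) ∞ μ) l (𝓝 0) := by
  refine ENNReal.tendsto_nhds_zero.2 fun δ hδ => ?_
  obtain ⟨η, hη, hηδ⟩ : ∃ η > 0, ENNReal.ofReal (∑ b, (⨆ x : R b, |w b x|) * η) ≤ δ := by
    have hcont : Continuous fun η : ℝ => ENNReal.ofReal (∑ b, (⨆ x : R b, |w b x|) * η) :=
      ENNReal.continuous_ofReal.comp (by fun_prop)
    have hlim := (hcont.tendsto' 0 0 (by simp)).mono_left (nhdsWithin_le_nhds (s := Ioi 0))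
    exact ((eventually_mem_nhdsWithin).and (hlim.eventually_le_const hδ)).exists
  have hclose : ∀ᶠ i in l, ∀ b, μ (R b) ≠ 0 → ∀ x, |F i b x - f b x| ≤ η := by
    refine eventually_all.2 fun b => eventually_imp_distrib_left.2 fun hb => ?_
    filter_upwards [Metric.tendstoUniformly_iff.1 (hF b hb) η hη] with i hi x
    simpa [Real.dist_eq, abs_sub_comm] using (hi x).le
  filter_upwards [hclose] with i hi
  simp_rw [composed_sub]
  exact (eLpNorm_top_composed_le hw (fun _ => hη.le) hi).trans hηδ

end Composition

section InfluenceFunction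

variable {X Y : Type*} [MeasurableSpace X] [MeasurableSpace Y] {B : ℕ} {R : Fin B → Set X}
  {w : Fin B → X → ℝ} {S : ∀ b, Measure (R b × Y) → R b → ℝ} {P : Measure (X × Y)} {z : X × Y}

lemma IsInfluenceFunction.ae_eq {G G' : X → ℝ} (hG : IsInfluenceFunction w S P z G)
    (hG' : IsInfluenceFunction w S P z G') : G =ᵐ[P.fst] G' :=
  tendstoInMeasure_ae_unique (tendstoInMeasure_of_tendsto_eLpNorm_top hG.2)
    (tendstoInMeasure_of_tendsto_eLpNorm_top hG'.2)

lemma isInfluenceFunction_composed (hw : ∀ b, BddAbove (range fun x : R b => |w b x|))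
    {G : ∀ b, R b → ℝ} (hmem : MemLp (composed w G) ∞ P.fst)
    (hG : ∀ b, P.fst (R b) ≠ 0 → TendstoUniformly (fun ε x =>
      (S b (contaminatedLaw P (R b) z ε) x - S b (regionalLaw P (R b)) x) / ε) (G b) (𝓝[>] 0)) :
    IsInfluenceFunction w S P z (composed w G) := by
  refine ⟨hmem, ?_⟩
  simp only [contaminatedPredictor, composedPredictor, composed_sub, composed_div]
  simpa only [composed_sub] using tendsto_eLpNorm_top_composed_sub hw hG

theorem exists_isInfluenceFunction [IsFiniteMeasure P] (hR : ∀ b, MeasurableSet (R b))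
    (hw : ∀ b, Measurable (w b)) (hw_bdd : ∀ b, BddAbove (range fun x : R b => |w b x|))
    {H : Fin B → Type*} [∀ b, NormedAddCommGroup (H b)] [∀ b, InnerProductSpace ℝ (H b)]
    [∀ b, CompleteSpace (H b)] [∀ b, RKHS ℝ (H b) (R b) ℝ]
    (hk : ∀ b, StronglyMeasurable (kernelSection (H b) : R b → H b)) {κ : Fin B → ℝ}
    (hκ : ∀ b (x : R b), ‖kernelSection (H b) x‖ ≤ κ b) {L : Y → ℝ → ℝ} {ℓ : ℝ≥0} {M : ℝ}
    (hL : IsSmoothLoss L ℓ M) {lam : Fin B → ℝ} (hlam : ∀ b, 0 < lam b)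
    (hS : ∀ b ν, IsLocalPredictor (H b) L (lam b) ν (S b ν)) (z : X × Y) :
    ∃ G, IsInfluenceFunction w S P z G ∧
      eLpNorm G ∞ P.fst ≤ ENNReal.ofReal (∑ b, (⨆ x : R b, |w b x|) * (ℓ * κ b ^ 2 / lam b)) := by
  have hregional : ∀ b, ∃ G : R b → ℝ, Measurable G ∧ (P.fst (R b) ≠ 0 →
      (∀ x, |G x| ≤ ℓ * κ b ^ 2 / lam b) ∧ TendstoUniformly (fun ε x =>
        (S b (contaminatedLaw P (R b) z ε) x - S b (regionalLaw P (R b)) x) / ε) G (𝓝[>] 0)) := by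
    intro b
    by_cases hP : P.fst (R b) = 0
    · exact ⟨0, measurable_const, fun h => absurd hP h⟩
    · exact (exists_tendstoUniformly_regional (hR b) hL (hk b) (hκ b) (hlam b) (hS b) hP z).imp
        fun _ hG => ⟨hG.1, fun _ => hG.2⟩
  choose G hmeas hG using hregional
  refine ⟨composed w G, isInfluenceFunction_composed hw_bdd
    (memLp_top_composed hR hw hw_bdd hmeas fun b hb => ⟨_, (hG b hb).1⟩) fun b hb => (hG b hb).2,
    eLpNorm_top_composed_le hw_bdd (fun b => ?_) fun b hb => (hG b hb).1⟩
  exact div_nonneg (mul_nonneg ℓ.coe_nonneg (sq_nonneg _)) (hlam b).le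

end InfluenceFunction

end LocalSVM

theorem theorem3p4_general {X Y : Type*} [MeasurableSpace X] [MeasurableSpace Y]
    {B : ℕ} {R : Fin B → Set X} (hR : ∀ b, MeasurableSet (R b))
    {w : Fin B → X → ℝ} (hw_meas : ∀ b, Measurable (w b))
    (hw_bdd : ∀ b, BddAbove (range fun x : R b => |w b x|))
    {lam : Fin B → ℝ} (hlam : ∀ b, 0 < lam b)
    {H : Fin B → Type*} [∀ b, NormedAddCommGroup (H b)] [∀ b, InnerProductSpace ℝ (H b)]
    [∀ b, CompleteSpace (H b)] [∀ b, RKHS ℝ (H b) (R b) ℝ]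
    (hk_bdd : ∀ b, BddAbove (range fun x : R b => √(LocalSVM.scalarKernel (H b) x x)))
    (hk_meas : ∀ b, StronglyMeasurable (LocalSVM.kernelSection (H b) : R b → H b))
    {L : Y → ℝ → ℝ} {ℓ : ℝ≥0} {M : ℝ} (hL : LocalSVM.IsSmoothLoss L ℓ M) :
    (∀ b, ∀ ν : Measure (R b × Y), IsFiniteMeasure ν →
      ∃! h : H b, LocalSVM.IsSVM L (lam b) ν h) ∧
    ∀ S : ∀ b, Measure (R b × Y) → R b → ℝ,
      (∀ b ν, LocalSVM.IsLocalPredictor (H b) L (lam b) ν (S b ν)) →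
      ∀ P : Measure (X × Y), IsFiniteMeasure P → ∀ z : X × Y,
        MemLp (LocalSVM.composedPredictor w S P) ∞ P.fst ∧
        (∀ ε ∈ Icc (0 : ℝ) 1, MemLp (LocalSVM.contaminatedPredictor w S P z ε) ∞ P.fst) ∧
        (∃ G, LocalSVM.IsInfluenceFunction w S P z G) ∧
        ∀ G, LocalSVM.IsInfluenceFunction w S P z G →
          eLpNorm G ∞ P.fst ≤ ENNReal.ofReal
            (ℓ * ∑ b, (⨆ x : R b, |w b x|) * (lam b)⁻¹ * LocalSVM.kernelNorm (H b) ^ 2) := by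
  have hκ := fun b => LocalSVM.norm_kernelSection_le_kernelNorm (hk_bdd b)
  refine ⟨fun b ν _ => LocalSVM.existsUnique_isSVM hL.toIsConvexLipschitzLoss (hk_meas b) (hκ b)
    (hlam b), fun S hS P _ z => ?_⟩
  have hmemLp : ∀ ν : ∀ b, Measure (R b × Y),
      (∀ b, P.fst (R b) ≠ 0 → IsProbabilityMeasure (ν b)) →
      MemLp (LocalSVM.composed w fun b => S b (ν b)) ∞ P.fst := fun ν hν =>
    LocalSVM.memLp_top_composed hR hw_meas hw_bdd (fun b => (hS b _).measurable (hk_meas b))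
      fun b hb => have := hν b hb; (hS b _).exists_abs_le (hκ b)
  obtain ⟨G, hG, hGle⟩ := LocalSVM.exists_isInfluenceFunction (P := P) hR hw_meas hw_bdd hk_meas hκ
    hL hlam hS z
  refine ⟨hmemLp _ fun b hb => LocalSVM.isProbabilityMeasure_regionalLaw (hR b) hb,
    fun ε hε => hmemLp _ fun b hb =>
      LocalSVM.isProbabilityMeasure_contaminatedLaw (hR b) hb z hε, ⟨G, hG⟩, fun G' hG' => ?_⟩
  rw [eLpNorm_congr_ae (hG'.ae_eq hG)]
  refine hGle.trans_eq (congrArg ENNReal.ofReal ?_)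
  rw [Finset.mul_sum]
  exact Finset.sum_congr rfl fun b _ => by ring

theorem theorem3p4
    {X : Type*} [MetricSpace X] [TopologicalSpace.SeparableSpace X]
    [MeasurableSpace X] [BorelSpace X]
    (Y : Set ℝ) (hY : IsClosed Y)
    -- regions, covering `X`
    (B : ℕ) (R : Fin B → Set X) (hR : ∀ b, IsComplete (R b)) (hcover : ⋃ b, R b = univ)
    -- weights
    (w : Fin B → X → ℝ) (hw_meas : ∀ b, Measurable (w b))
    (hw_mem : ∀ b x, w b x ∈ Icc (0 : ℝ) 1)
    (hw_sum : ∀ x, ∑ b, w b x = 1) (hw_zero : ∀ b, ∀ x ∉ R b, w b x = 0)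
    -- regularization parameters
    (lam : Fin B → ℝ) (hlam : ∀ b, 0 < lam b)
    -- local reproducing kernel Hilbert spaces with bounded and continuous kernels
    (H : Fin B → Type*) [∀ b, NormedAddCommGroup (H b)] [∀ b, InnerProductSpace ℝ (H b)]
    [∀ b, CompleteSpace (H b)] [∀ b, RKHS ℝ (H b) (R b) ℝ]
    (hk_bdd : ∀ b, BddAbove (range fun x : R b => √(LocalSVM.scalarKernel (H b) x x)))
    (hk_cont : ∀ b, Continuous fun p : R b × R b => LocalSVM.scalarKernel (H b) p.1 p.2)
    -- the loss function, with Lipschitz constant `ℓ`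
    (L : Y → ℝ → ℝ) (hL_nonneg : ∀ y t, 0 ≤ L y t)
    (hL_meas : Measurable (Function.uncurry L))
    (hL_conv : ∀ y, ConvexOn ℝ univ (L y))
    (ℓ : ℝ≥0) (hL_lip : ∀ y, LipschitzWith ℓ (L y))
    (hL_diff : ∀ y, ContDiff ℝ 2 (L y))
    (hL_deriv : (⨆ y, ⨆ t, ‖deriv (L y) t‖ₑ) ∈ Ioo (0 : ℝ≥0∞) ∞)
    (hL_deriv2 : (⨆ y, ⨆ t, ‖iteratedDeriv 2 (L y) t‖ₑ) < ∞) :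
    -- the local SVMs exist and are unique
    (∀ b, ∀ ν : Measure (R b × Y), IsProbabilityMeasure ν →
      ∃! h : H b, LocalSVM.IsSVM L (lam b) ν h) ∧
    -- for all local statistical operators, all laws `P` and all points `z`
    ∀ S : ∀ b, Measure (R b × Y) → R b → ℝ,
      (∀ b ν, LocalSVM.IsLocalPredictor (H b) L (lam b) ν (S b ν)) →
      ∀ P : Measure (X × Y), IsProbabilityMeasure P → ∀ z : X × Y,
        -- the composed predictors belong to `L^∞(P^X)`,
        MemLp (LocalSVM.composedPredictor w S P) ∞ P.fst ∧
        (∀ ε ∈ Ioc (0 : ℝ) 1, MemLp (LocalSVM.contaminatedPredictor w S P z ε) ∞ P.fst) ∧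
        -- the influence function exists,
        (∃ G, LocalSVM.IsInfluenceFunction w S P z G) ∧
        -- and it satisfies the bound
        ∀ G, LocalSVM.IsInfluenceFunction w S P z G →
          eLpNorm G ∞ P.fst ≤ ENNReal.ofReal
            (2 * ℓ * ∑ b, (⨆ x : R b, w b x) * (lam b)⁻¹ * LocalSVM.kernelNorm (H b) ^ 2) := by
  obtain ⟨M, hL⟩ := LocalSVM.IsConvexLipschitzLoss.exists_isSmoothLoss
    ⟨hL_meas, hL_conv, hL_lip⟩ hL_diff hL_deriv2
  have habs : ∀ b x, |w b x| = w b x := fun b x => abs_of_nonneg (hw_mem b x).1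
  obtain ⟨hsvm, hIF⟩ := theorem3p4_general (fun b => (hR b).isClosed.measurableSet) hw_meas
    (fun b => ⟨1, forall_mem_range.2 fun x => (habs b x).trans_le (hw_mem b x).2⟩) hlam hk_bdd
    (fun b => (LocalSVM.continuous_kernelSection (hk_cont b)).stronglyMeasurable) hL
  refine ⟨fun b ν _ => hsvm b ν inferInstance, fun S hS P _ z => ?_⟩
  obtain ⟨hmem, hmem_cont, hex, hbound⟩ := hIF S hS P inferInstance z
  refine ⟨hmem, fun ε hε => hmem_cont ε ⟨hε.1.le, hε.2⟩, hex, fun G hG => (hbound G hG).trans ?_⟩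
  have hsum : 0 ≤ ∑ b, (⨆ x : R b, w b x) * (lam b)⁻¹ * LocalSVM.kernelNorm (H b) ^ 2 :=
    Finset.sum_nonneg fun b _ => mul_nonneg (mul_nonneg
      (Real.iSup_nonneg fun x => (hw_mem b x).1) (inv_nonneg.2 (hlam b).le)) (sq_nonneg _)
  simp only [habs]
  exact ENNReal.ofReal_le_ofReal (mul_le_mul_of_nonneg_right
    (le_mul_of_one_le_left ℓ.coe_nonneg one_le_two) hsum)
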